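/- Let $n\ge 2$, and let $G_k^{(n)}$ be the Gegenbauer polynomials defined by $G_0^{(n)}=1$, $G_1^{(n)}=t$ and $G_k^{(n)}=\dfrac{(2k+n-4)\,t\,G_{k-1}^{(n)}-(k-1)\,G_{k-2}^{(n)}}{k+n-3}$ for $k\ge 2$. Let $f$ be a real function on $[-1,1]$ that is the sum of a Gegenbauer series $f(t)=\sum_{k=0}^\infty f_k\,G_k^{(n)}(t)$ converging uniformly on $[-1,1]$, with $f_k\ge 0$ for all $k\ge 0$. For a finite set $P\subset\mathbb S^{n-1}$ (unit vectors in $\mathbb R^n$) let $D(P)=\{x\cdot y : x,y\in P,\ x\ne y\}$, let $M_k(P)=\sum_{x\in P}\sum_{y\in P}G_k^{(n)}(x\cdot y)$, and let $Z_f=\{t\in[-1,1) : f(t)=0\}$. The set $P$ is called an $f$-design if $M_k(P)=0$ for every $k>0$ with $f_k\ne 0$, and $D(P)\subset Z_f$. Theorem. Let $P\subset\mathbb S^{n-1}$ be a non-empty finite set with $|P|=m$ and $D(P)\subset Z_f$. Then $P$ is an $f$-design if and only if $f(1)=m f_0$. -/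

import Mathlib

namespace FDesign

/-- The unit sphere `S^{n-1}` in `ℝⁿ`. -/
abbrev UnitSphere (n : ℕ) : Type :=
  Metric.sphere (0 : EuclideanSpace ℝ (Fin n)) 1

/-- The Gegenbauer polynomials `G_k^{(n)}` (for `n ≥ 2`), given by `G_0 = 1`, `G_1 = t` and
`G_k = ((2k + n - 4) t G_{k-1} - (k - 1) G_{k-2}) / (k + n - 3)` for `k ≥ 2`
(the index `k` of this formula is `k + 2` in the last clause). -/
noncomputable def gegenbauer (n : ℕ) : ℕ → Polynomial ℝ
  | 0 => 1
  | 1 => Polynomial.X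
  | k + 2 =>
      Polynomial.C (((k : ℝ) + 2 + n - 3)⁻¹) *
        (Polynomial.C (2 * ((k : ℝ) + 2) + n - 4) * Polynomial.X * gegenbauer n (k + 1)
          - Polynomial.C ((k : ℝ) + 2 - 1) * gegenbauer n k)

/-- The Gegenbauer series `∑ a_k G_k^{(n)}` converges to `f` uniformly on `[-1, 1]`. -/
def HasGegenbauerExpansion (n : ℕ) (f : ℝ → ℝ) (a : ℕ → ℝ) : Prop :=
  TendstoUniformlyOn
    (fun (N : ℕ) (t : ℝ) => ∑ k ∈ Finset.range N, a k * (gegenbauer n k).eval t)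
    f Filter.atTop (Set.Icc (-1) 1)

/-- The inner product `x · y` of two points of the sphere. -/
noncomputable def dot {n : ℕ} (x y : UnitSphere n) : ℝ :=
  inner ℝ (x : EuclideanSpace ℝ (Fin n)) (y : EuclideanSpace ℝ (Fin n))

/-- The `k`-th moment `M_k(P) = ∑_{i,j} G_k^{(n)}(p_i · p_j)`, diagonal pairs included. -/
noncomputable def moment {n : ℕ} (k : ℕ) (P : Finset (UnitSphere n)) : ℝ :=
  ∑ x ∈ P, ∑ y ∈ P, (gegenbauer n k).eval (dot x y)

/-- `D(P)`: the inner products of pairs of distinct points of `P`. -/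
def innerProducts {n : ℕ} (P : Finset (UnitSphere n)) : Set ℝ :=
  {t | ∃ x ∈ P, ∃ y ∈ P, x ≠ y ∧ dot x y = t}

/-- `Z_f`: the zeros of `f` in `[-1, 1)`. -/
def zeroSet (f : ℝ → ℝ) : Set ℝ :=
  {t | t ∈ Set.Ico (-1 : ℝ) 1 ∧ f t = 0}

/-- `P` is an `f`-design, where `f = ∑ a_k G_k^{(n)}` on `[-1, 1]`. -/
structure IsFDesign {n : ℕ} (f : ℝ → ℝ) (a : ℕ → ℝ) (P : Finset (UnitSphere n)) : Prop where
  moment_eq_zero : ∀ k : ℕ, 0 < k → a k ≠ 0 → moment k P = 0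
  innerProducts_subset : innerProducts P ⊆ zeroSet f

end FDesign

/-! Sum `f (dot x y)` over all pairs in two ways. Off-diagonal terms vanish because D(P) lies in
Z_f, so the sum is m f(1) (`sum_sum_dot`); the expansion turns it into ∑ a_k M_k, whose zeroth term
is a_0 m² (`hasSum_moment`). All terms are nonnegative, so f(1) = m a_0 exactly when every term with
k > 0 vanishes.

Nonnegativity of M_k is Schoenberg's theorem (`moment_nonneg`). The polynomial G_k(x · u) is
homogenised in u to a harmonic `zonal x k`, which represents evaluation at x, up to a positive
constant, in the Fischer inner product. Then c M_k is the Fischer square of ∑ `zonal x k` over P. -/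

namespace FDesign

open MvPolynomial

variable {n : ℕ}

/-! ### The Fischer inner product -/

section Fischer

/-- The Fischer (apolar) inner product of two real polynomials. -/
noncomputable def fischer (p q : MvPolynomial (Fin n) ℝ) : ℝ :=
  ∑ α ∈ p.support, (∏ i, ((α i).factorial : ℝ)) * p.coeff α * q.coeff α

theorem fischer_eq_sum {p : MvPolynomial (Fin n) ℝ} (q : MvPolynomial (Fin n) ℝ)
    {s : Finset (Fin n →₀ ℕ)} (hs : p.support ⊆ s) :
    fischer p q = ∑ α ∈ s, (∏ i, ((α i).factorial : ℝ)) * p.coeff α * q.coeff α := by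
  refine Finset.sum_subset hs fun α _ hα => ?_
  rw [notMem_support_iff.mp hα]
  ring

theorem fischer_comm (p q : MvPolynomial (Fin n) ℝ) : fischer p q = fischer q p := by
  classical
  rw [fischer_eq_sum q (Finset.subset_union_left (s₂ := q.support)),
    fischer_eq_sum p (Finset.subset_union_right (s₁ := p.support))]
  exact Finset.sum_congr rfl fun α _ => by ring

theorem fischer_self_nonneg (p : MvPolynomial (Fin n) ℝ) : 0 ≤ fischer p p := by
  refine Finset.sum_nonneg fun α _ => ?_
  rw [mul_assoc]
  exact mul_nonneg (by positivity) (mul_self_nonneg _)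

theorem fischer_add_right (p q r : MvPolynomial (Fin n) ℝ) :
    fischer p (q + r) = fischer p q + fischer p r := by
  simp only [fischer, coeff_add, mul_add, Finset.sum_add_distrib]

theorem fischer_C_mul_right (p : MvPolynomial (Fin n) ℝ) (c : ℝ) (q : MvPolynomial (Fin n) ℝ) :
    fischer p (C c * q) = c * fischer p q := by
  simp only [fischer, coeff_C_mul, Finset.mul_sum]
  exact Finset.sum_congr rfl fun α _ => by ring

theorem fischer_zero_right (p : MvPolynomial (Fin n) ℝ) : fischer p 0 = 0 := by
  simp [fischer]

theorem fischer_sum_right {ι : Type*} (p : MvPolynomial (Fin n) ℝ) (s : Finset ι)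
    (q : ι → MvPolynomial (Fin n) ℝ) :
    fischer p (∑ j ∈ s, q j) = ∑ j ∈ s, fischer p (q j) := by
  simp only [fischer, coeff_sum, Finset.mul_sum]
  exact Finset.sum_comm

theorem fischer_sum_left {ι : Type*} (s : Finset ι) (p : ι → MvPolynomial (Fin n) ℝ)
    (q : MvPolynomial (Fin n) ℝ) :
    fischer (∑ j ∈ s, p j) q = ∑ j ∈ s, fischer (p j) q := by
  simp only [fischer_comm _ q, fischer_sum_right]

theorem fischer_C_mul_left (c : ℝ) (p q : MvPolynomial (Fin n) ℝ) :
    fischer (C c * p) q = c * fischer p q := by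
  simp only [fischer_comm _ q, fischer_C_mul_right]

theorem fischer_sub_left (p r q : MvPolynomial (Fin n) ℝ) :
    fischer (p - r) q = fischer p q - fischer r q := by
  have h := fischer_add_right q (p - r) r
  rw [sub_add_cancel] at h
  simp only [fischer_comm _ q, h, add_sub_cancel_right]

/-- The factor α_i + 1 is also the one produced by `coeff_pderiv`; this match is why the weight α!
makes `fischer_X_mul` true. -/
theorem prod_factorial_add_single (α : Fin n →₀ ℕ) (i : Fin n) :
    ∏ j, (((Finsupp.single i 1 + α : Fin n →₀ ℕ) j).factorial : ℝ)
      = (α i + 1) * ∏ j, ((α j).factorial : ℝ) := by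
  classical
  rw [← Finset.mul_prod_erase Finset.univ _ (Finset.mem_univ i),
    ← Finset.mul_prod_erase Finset.univ (fun j => ((α j).factorial : ℝ)) (Finset.mem_univ i),
    ← mul_assoc]
  congr 1
  · simp [add_comm 1, Nat.factorial_succ]
  · refine Finset.prod_congr rfl fun j hj => ?_
    simp [(Finset.ne_of_mem_erase hj).symm]

/-- Multiplication by a variable is adjoint to differentiation. -/
theorem fischer_X_mul (i : Fin n) (p q : MvPolynomial (Fin n) ℝ) :
    fischer (X i * p) q = fischer p (pderiv i q) := by
  rw [fischer, support_X_mul, Finset.sum_map, fischer]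
  refine Finset.sum_congr rfl fun α _ => ?_
  rw [addLeftEmbedding_apply, coeff_X_mul, prod_factorial_add_single, coeff_pderiv,
    add_comm α]
  ring

end Fischer

/-! ### Laplacian, directional derivatives and their adjoints -/

section Laplacian

/-- The linear form `u ↦ x · u`. -/
noncomputable def linForm (x : Fin n → ℝ) : MvPolynomial (Fin n) ℝ := ∑ i, C (x i) * X i

/-- The quadratic form `u ↦ u · u`. -/
noncomputable def normSqForm (n : ℕ) : MvPolynomial (Fin n) ℝ := ∑ i, X i * X i

/-- The derivative in direction `x`. -/
noncomputable def dirDeriv (x : Fin n → ℝ) :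
    Derivation ℝ (MvPolynomial (Fin n) ℝ) (MvPolynomial (Fin n) ℝ) :=
  mkDerivation ℝ fun i => C (x i)

/-- The Laplacian. -/
noncomputable def laplacian (p : MvPolynomial (Fin n) ℝ) : MvPolynomial (Fin n) ℝ :=
  ∑ i, pderiv i (pderiv i p)

theorem dirDeriv_eq_sum (x : Fin n → ℝ) (p : MvPolynomial (Fin n) ℝ) :
    dirDeriv x p = ∑ i, C (x i) * pderiv i p := by
  classical
  have e : ∀ q, (∑ i, (C (x i) : MvPolynomial (Fin n) ℝ) • pderiv i) q
      = ∑ i, C (x i) * pderiv i q := fun q => by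
    have := congrFun (map_sum (Derivation.coeFnAddMonoidHom (R := ℝ))
      (fun i => (C (x i) : MvPolynomial (Fin n) ℝ) • pderiv i) Finset.univ) q
    rw [Finset.sum_apply] at this
    exact this
  have h : dirDeriv x = ∑ i, (C (x i) : MvPolynomial (Fin n) ℝ) • pderiv i := by
    refine derivation_ext fun j => ?_
    rw [e]
    simp [dirDeriv, mkDerivation_X, pderiv_X, Pi.single_apply]
  rw [h, e]

/-- The commutator of two derivations is a derivation, and it kills the variables. -/
theorem pderiv_pderiv_comm (i j : Fin n) (p : MvPolynomial (Fin n) ℝ) :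
    pderiv i (pderiv j p) = pderiv j (pderiv i p) := by
  classical
  have h : ⁅(pderiv i : Derivation ℝ (MvPolynomial (Fin n) ℝ) (MvPolynomial (Fin n) ℝ)),
      (pderiv j : Derivation ℝ (MvPolynomial (Fin n) ℝ) (MvPolynomial (Fin n) ℝ))⁆ = 0 := by
    refine derivation_ext fun k => ?_
    simp only [Derivation.commutator_apply, pderiv_X, Pi.single_apply, Derivation.coe_zero,
      Pi.zero_apply]
    split_ifs <;> simp
  have h' := congrArg (fun D => D p) h
  simpa [Derivation.commutator_apply, sub_eq_zero] using h'

theorem laplacian_dirDeriv (x : Fin n → ℝ) (p : MvPolynomial (Fin n) ℝ) :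
    laplacian (dirDeriv x p) = dirDeriv x (laplacian p) := by
  simp only [laplacian, dirDeriv_eq_sum, map_sum, pderiv_C_mul]
  refine Finset.sum_congr rfl fun i _ => Finset.sum_congr rfl fun j _ => ?_
  rw [pderiv_pderiv_comm i j p, pderiv_pderiv_comm i j]

theorem pderiv_linForm (x : Fin n → ℝ) (i : Fin n) : pderiv i (linForm x) = C (x i) := by
  classical
  simp [linForm, pderiv_X, Pi.single_apply]

theorem pderiv_normSqForm (i : Fin n) : pderiv i (normSqForm n) = 2 * X i := by
  classical
  simp [normSqForm, pderiv_X, Pi.single_apply, Finset.sum_add_distrib, two_mul]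

theorem laplacian_sub (p q : MvPolynomial (Fin n) ℝ) :
    laplacian (p - q) = laplacian p - laplacian q := by
  simp [laplacian, Finset.sum_sub_distrib]

theorem laplacian_C_mul (c : ℝ) (p : MvPolynomial (Fin n) ℝ) :
    laplacian (C c * p) = C c * laplacian p := by
  simp only [laplacian, pderiv_C_mul, Finset.mul_sum]

theorem laplacian_linForm_mul (x : Fin n → ℝ) (p : MvPolynomial (Fin n) ℝ) :
    laplacian (linForm x * p) = linForm x * laplacian p + 2 * dirDeriv x p := by
  simp only [laplacian, dirDeriv_eq_sum, pderiv_mul, pderiv_linForm, map_add,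
    pderiv_C, Finset.mul_sum, ← Finset.sum_add_distrib]
  exact Finset.sum_congr rfl fun i _ => by ring

/-- Euler's identity turns the cross term 4 ∑ X_i ∂_i p into 4k p; the term 2n p comes from Δ|u|² =
2n. -/
theorem laplacian_normSqForm_mul {k : ℕ} {p : MvPolynomial (Fin n) ℝ} (hp : p.IsHomogeneous k) :
    laplacian (normSqForm n * p)
      = normSqForm n * laplacian p + (4 * (k : MvPolynomial (Fin n) ℝ) + 2 * n) * p := by
  have e : (4 * (k : MvPolynomial (Fin n) ℝ) + 2 * n) * p
      = ∑ i : Fin n, (4 * (X i * pderiv i p) + 2 * p) := by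
    rw [Finset.sum_add_distrib, ← Finset.mul_sum, hp.sum_X_mul_pderiv]
    simp
    ring
  have two : ∀ (i : Fin n) (q : MvPolynomial (Fin n) ℝ),
      pderiv i (2 * q) = 2 * pderiv i q := fun i q => by
    rw [two_mul, map_add, two_mul]
  rw [e]
  simp only [laplacian, pderiv_mul, pderiv_normSqForm, map_add, mul_assoc, two,
    Finset.mul_sum, ← Finset.sum_add_distrib]
  refine Finset.sum_congr rfl fun i _ => ?_
  rw [pderiv_X_self]
  ring

theorem dirDeriv_linForm (x : Fin n → ℝ) : dirDeriv x (linForm x) = C (∑ i, x i * x i) := by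
  simp [dirDeriv_eq_sum, pderiv_linForm]

theorem dirDeriv_normSqForm (x : Fin n → ℝ) : dirDeriv x (normSqForm n) = 2 * linForm x := by
  simp only [dirDeriv_eq_sum, pderiv_normSqForm, linForm, Finset.mul_sum]
  exact Finset.sum_congr rfl fun i _ => by ring

theorem isHomogeneous_dirDeriv (x : Fin n → ℝ) {k : ℕ} {p : MvPolynomial (Fin n) ℝ}
    (hp : p.IsHomogeneous (k + 1)) : (dirDeriv x p).IsHomogeneous k := by
  rw [dirDeriv_eq_sum]
  exact IsHomogeneous.sum _ _ _ fun i _ => (hp.pderiv (i := i)).C_mul _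

theorem eval_dirDeriv_self (x : Fin n → ℝ) {k : ℕ} {p : MvPolynomial (Fin n) ℝ}
    (hp : p.IsHomogeneous k) : eval x (dirDeriv x p) = k * eval x p := by
  have h := congrArg (eval x) hp.sum_X_mul_pderiv
  simpa [dirDeriv_eq_sum] using h

theorem fischer_linForm_mul (x : Fin n → ℝ) (p q : MvPolynomial (Fin n) ℝ) :
    fischer (linForm x * p) q = fischer p (dirDeriv x q) := by
  simp only [linForm, Finset.sum_mul, fischer_sum_left, mul_assoc, fischer_C_mul_left,
    fischer_X_mul, dirDeriv_eq_sum, fischer_sum_right, fischer_C_mul_right]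

theorem fischer_normSqForm_mul (p q : MvPolynomial (Fin n) ℝ) :
    fischer (normSqForm n * p) q = fischer p (laplacian q) := by
  simp only [normSqForm, Finset.sum_mul, fischer_sum_left, mul_assoc, fischer_X_mul, laplacian,
    fischer_sum_right]

end Laplacian

/-! ### Zonal harmonics and their reproducing property -/

section Zonal

/-- The solid zonal harmonic with pole `x`: it restricts to `u ↦ G_k(x · u)` on the sphere. -/
noncomputable def zonal (x : Fin n → ℝ) : ℕ → MvPolynomial (Fin n) ℝ
  | 0 => 1
  | 1 => linForm x
  | k + 2 =>
      C (((k : ℝ) + 2 + n - 3)⁻¹) *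
        (C (2 * ((k : ℝ) + 2) + n - 4) * (linForm x * zonal x (k + 1))
          - C ((k : ℝ) + 2 - 1) * (normSqForm n * zonal x k))

theorem zonal_add_two (x : Fin n → ℝ) (k : ℕ) :
    zonal x (k + 2) = C (((k : ℝ) + 2 + n - 3)⁻¹) *
        (C (2 * ((k : ℝ) + 2) + n - 4) * (linForm x * zonal x (k + 1))
          - C ((k : ℝ) + 2 - 1) * (normSqForm n * zonal x k)) := by
  rw [zonal]

theorem recurrence_denom_pos (hn : 2 ≤ n) (k : ℕ) : (0 : ℝ) < (k : ℝ) + 2 + n - 3 := by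
  have : (2 : ℝ) ≤ n := by exact_mod_cast hn
  have : (0 : ℝ) ≤ k := k.cast_nonneg
  linarith

theorem zonal_recurrence (hn : 2 ≤ n) (x : Fin n → ℝ) (k : ℕ) :
    ((k : MvPolynomial (Fin n) ℝ) + n - 1) * zonal x (k + 2)
      = (2 * k + n) * (linForm x * zonal x (k + 1)) - (k + 1) * (normSqForm n * zonal x k) := by
  have h : C ((k : ℝ) + 2 + n - 3) * C (((k : ℝ) + 2 + n - 3)⁻¹)
      = (1 : MvPolynomial (Fin n) ℝ) := by
    rw [← C_mul, mul_inv_cancel₀ (recurrence_denom_pos hn k).ne', C_1]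
  rw [zonal_add_two]
  simp only [map_add, map_sub, map_mul, map_natCast, map_ofNat, map_one] at h ⊢
  linear_combination ((2 * k + n) * (linForm x * zonal x (k + 1))
    - (k + 1) * (normSqForm n * zonal x k)) * h

theorem isHomogeneous_linForm (x : Fin n → ℝ) : (linForm x).IsHomogeneous 1 :=
  IsHomogeneous.sum _ _ _ fun i _ => (isHomogeneous_X ℝ i).C_mul _

theorem isHomogeneous_normSqForm : (normSqForm n).IsHomogeneous 2 :=
  IsHomogeneous.sum _ _ _ fun i _ => (isHomogeneous_X ℝ i).mul (isHomogeneous_X ℝ i)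

theorem isHomogeneous_zonal (x : Fin n → ℝ) (k : ℕ) : (zonal x k).IsHomogeneous k := by
  induction k using Nat.twoStepInduction with
  | zero => exact isHomogeneous_one _ _
  | one => exact isHomogeneous_linForm x
  | more k h0 h1 =>
    rw [zonal_add_two]
    refine IsHomogeneous.C_mul (IsHomogeneous.sub ?_ ?_) _
    · have := ((isHomogeneous_linForm x).mul h1).C_mul (2 * ((k : ℝ) + 2) + n - 4)
      rwa [show 1 + (k + 1) = k + 2 by ring] at this
    · have := ((isHomogeneous_normSqForm (n := n)).mul h0).C_mul ((k : ℝ) + 2 - 1)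
      rwa [show 2 + k = k + 2 by ring] at this

theorem natCast_add_sub_one_ne_zero (hn : 2 ≤ n) (k : ℕ) :
    (k : MvPolynomial (Fin n) ℝ) + n - 1 ≠ 0 := by
  have h : (k : MvPolynomial (Fin n) ℝ) + n - 1 = ((k + n - 1 : ℕ) : MvPolynomial (Fin n) ℝ) := by
    rw [Nat.cast_sub (by omega)]
    push_cast
    ring
  rw [h, Nat.cast_ne_zero]
  omega

/-- The zonal harmonics with pole `x` form an Appell sequence in direction `x`. -/
theorem dirDeriv_zonal (hn : 2 ≤ n) {x : Fin n → ℝ} (hx : ∑ i, x i * x i = 1) (k : ℕ) :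
    dirDeriv x (zonal x (k + 1)) = (k + 1) * zonal x k := by
  have hl : dirDeriv x (linForm x) = 1 := by rw [dirDeriv_linForm, hx, C_1]
  have step : ∀ k : ℕ, ((k : MvPolynomial (Fin n) ℝ) + n - 1) * dirDeriv x (zonal x (k + 2))
      = (2 * k + n) * (zonal x (k + 1) + linForm x * dirDeriv x (zonal x (k + 1)))
        - (k + 1) * (2 * linForm x * zonal x k + normSqForm n * dirDeriv x (zonal x k)) := by
    intro k
    have h := congrArg (dirDeriv x) (zonal_recurrence hn x k)
    -- The coefficients are written as constants `C _`, so that the Leibniz rule discards their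
    -- derivatives.
    have c (a : ℝ) : dirDeriv x (C a) = 0 := derivation_C _ _
    have e1 : (k : MvPolynomial (Fin n) ℝ) + n - 1 = (C ((k : ℝ) + (n : ℝ) - 1) : MvPolynomial (Fin n) ℝ) := by simp
    have e2 : 2 * (k : MvPolynomial (Fin n) ℝ) + n = (C (2 * (k : ℝ) + (n : ℝ)) : MvPolynomial (Fin n) ℝ) := by
      simp only [map_add, map_mul, map_natCast, map_ofNat]
    have e3 : (k : MvPolynomial (Fin n) ℝ) + 1 = (C ((k : ℝ) + 1) : MvPolynomial (Fin n) ℝ) := by simp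
    rw [e1, e2, e3] at h ⊢
    simp only [map_sub (dirDeriv x), Derivation.leibniz, c, hl, dirDeriv_normSqForm,
      smul_eq_mul] at h
    linear_combination h
  induction k using Nat.strong_induction_on with
  | _ k ih =>
    match k with
    | 0 => simp [zonal, hl]
    | 1 =>
      refine mul_left_cancel₀ (natCast_add_sub_one_ne_zero hn 0) ?_
      rw [step 0]
      simp only [zonal, hl, Derivation.map_one_eq_zero]
      push_cast
      ring
    | k + 2 =>
      refine mul_left_cancel₀ (natCast_add_sub_one_ne_zero hn (k + 1)) ?_
      rw [step (k + 1), ih (k + 1) (by omega), ih k (by omega)]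
      have h := zonal_recurrence hn x k
      push_cast
      linear_combination -((k : MvPolynomial (Fin n) ℝ) + 2) * h

/-- In the recurrence, the linear-form term contributes 2(2k+n)(k+1) Z_k by the Appell property, and
the norm-square term contributes (k+1)(4k+2n) Z_k; they cancel. -/
theorem laplacian_zonal (hn : 2 ≤ n) {x : Fin n → ℝ} (hx : ∑ i, x i * x i = 1) (k : ℕ) :
    laplacian (zonal x k) = 0 := by
  induction k using Nat.twoStepInduction with
  | zero => simp [zonal, laplacian]
  | one => simp [zonal, laplacian, pderiv_linForm]
  | more k h0 h1 =>
    rw [zonal_add_two, laplacian_C_mul, laplacian_sub, laplacian_C_mul, laplacian_C_mul,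
      laplacian_linForm_mul, laplacian_normSqForm_mul (isHomogeneous_zonal x k), h0, h1,
      dirDeriv_zonal hn hx]
    simp only [map_add, map_sub, map_mul, map_natCast, map_ofNat, map_one]
    ring

/-- Reproducing property of the zonal harmonics. -/
theorem exists_pos_fischer_zonal (hn : 2 ≤ n) (k : ℕ) :
    ∃ c : ℝ, 0 < c ∧ ∀ (x : Fin n → ℝ) (h : MvPolynomial (Fin n) ℝ), h.IsHomogeneous k →
      laplacian h = 0 → fischer (zonal x k) h = c * eval x h := by
  have base (x : Fin n → ℝ) (h : MvPolynomial (Fin n) ℝ) (hh : h.IsHomogeneous 0) :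
      fischer (zonal x 0) h = eval x h := by
    rw [← totalDegree_zero_iff_isHomogeneous, totalDegree_eq_zero_iff_eq_C] at hh
    rw [hh]
    simp [zonal, fischer, support_one]
  induction k with
  | zero => exact ⟨1, one_pos, fun x h hh _ => by rw [base x h hh, one_mul]⟩
  | succ k ih =>
    obtain ⟨c, hc, H⟩ := ih
    have key (x : Fin n → ℝ) (h : MvPolynomial (Fin n) ℝ) (hh : h.IsHomogeneous (k + 1))
        (hl : laplacian h = 0) :
        fischer (zonal x k) (dirDeriv x h) = c * ((k + 1 : ℕ) * eval x h) := by
      rw [H x _ (isHomogeneous_dirDeriv x hh) (by rw [laplacian_dirDeriv, hl, map_zero]),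
        eval_dirDeriv_self x hh]
    -- Degree one lies outside the three-term recurrence. In higher degrees the norm-square term
    -- pairs to zero with a harmonic h, and the linear form becomes differentiation along x,
    -- evaluated by Euler's identity.
    cases k with
    | zero =>
      refine ⟨c, hc, fun x h hh hl => ?_⟩
      have := key x h hh hl
      rw [← fischer_linForm_mul] at this
      simpa [zonal] using this
    | succ k =>
      have hd := recurrence_denom_pos hn k
      have hN : (0 : ℝ) < 2 * ((k : ℝ) + 2) + n - 4 := by
        have : (2 : ℝ) ≤ n := by exact_mod_cast hn
        have : (0 : ℝ) ≤ k := k.cast_nonneg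
        linarith
      refine ⟨((k : ℝ) + 2 + n - 3)⁻¹ * (2 * ((k : ℝ) + 2) + n - 4) * (c * (k + 1 + 1 : ℕ)),
        by positivity, fun x h hh hl => ?_⟩
      rw [zonal_add_two, fischer_C_mul_left, fischer_sub_left, fischer_C_mul_left,
        fischer_C_mul_left, fischer_normSqForm_mul, hl, fischer_zero_right, fischer_linForm_mul,
        key x h hh hl]
      ring

theorem eval_zonal {x u : Fin n → ℝ} (hu : ∑ i, u i * u i = 1) (k : ℕ) :
    eval u (zonal x k) = (gegenbauer n k).eval (∑ i, x i * u i) := by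
  have hl : eval u (linForm x) = ∑ i, x i * u i := by simp [linForm]
  have hr : eval u (normSqForm n) = 1 := by simp [normSqForm, hu]
  induction k using Nat.twoStepInduction with
  | zero => simp [zonal, gegenbauer]
  | one => simp [zonal, gegenbauer, hl]
  | more k h0 h1 =>
    rw [zonal_add_two, gegenbauer]
    simp only [eval_mul, eval_sub, eval_C, Polynomial.eval_mul, Polynomial.eval_sub,
      Polynomial.eval_C, Polynomial.eval_X, hl, hr, h0, h1]
    ring

end Zonal

/-! ### Schoenberg's theorem and sums over pairs -/

section Sphere

theorem dot_eq_sum (x y : UnitSphere n) :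
    dot x y = ∑ i, (x : EuclideanSpace ℝ (Fin n)) i * (y : EuclideanSpace ℝ (Fin n)) i := by
  rw [dot, PiLp.inner_apply]
  exact Finset.sum_congr rfl fun i _ => by simp [mul_comm]

theorem dot_self (x : UnitSphere n) : dot x x = 1 := by
  simp [dot]

theorem dot_mem_Icc (x y : UnitSphere n) : dot x y ∈ Set.Icc (-1 : ℝ) 1 := by
  have h := abs_real_inner_le_norm (x : EuclideanSpace ℝ (Fin n)) y
  rw [norm_eq_of_mem_sphere, norm_eq_of_mem_sphere, one_mul] at h
  exact abs_le.mp h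

/-- **Schoenberg's theorem**: the Gegenbauer polynomials are positive definite on the sphere. -/
theorem moment_nonneg (hn : 2 ≤ n) (k : ℕ) (P : Finset (UnitSphere n)) : 0 ≤ moment k P := by
  obtain ⟨c, hc, H⟩ := exists_pos_fischer_zonal hn k
  have hs (x : UnitSphere n) : ∑ i, (x : EuclideanSpace ℝ (Fin n)) i *
      (x : EuclideanSpace ℝ (Fin n)) i = 1 := by rw [← dot_eq_sum, dot_self]
  let Z (x : UnitSphere n) := zonal (fun i => (x : EuclideanSpace ℝ (Fin n)) i) k
  have e : fischer (∑ x ∈ P, Z x) (∑ x ∈ P, Z x) = c * moment k P := by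
    rw [fischer_sum_right, moment, Finset.mul_sum]
    refine Finset.sum_congr rfl fun x _ => ?_
    rw [fischer_sum_left, Finset.mul_sum]
    refine Finset.sum_congr rfl fun y _ => ?_
    rw [H _ _ (isHomogeneous_zonal _ k) (laplacian_zonal hn (hs x) k), eval_zonal (hs y),
      dot_eq_sum]
  exact nonneg_of_mul_nonneg_right (e ▸ fischer_self_nonneg _) hc

theorem moment_zero (P : Finset (UnitSphere n)) : moment 0 P = (P.card : ℝ) ^ 2 := by
  simp [moment, gegenbauer, sq]

theorem sum_sum_dot {f : ℝ → ℝ} {P : Finset (UnitSphere n)} (hD : innerProducts P ⊆ zeroSet f) :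
    ∑ x ∈ P, ∑ y ∈ P, f (dot x y) = P.card * f 1 := by
  have h : ∀ x ∈ P, ∑ y ∈ P, f (dot x y) = f 1 := fun x hx => by
    rw [Finset.sum_eq_single_of_mem x hx fun y hy hyx => (hD ⟨x, hx, y, hy, hyx.symm, rfl⟩).2,
      dot_self]
  rw [Finset.sum_congr rfl h, Finset.sum_const, nsmul_eq_mul]

theorem HasGegenbauerExpansion.hasSum_moment (hn : 2 ≤ n) {f : ℝ → ℝ} {a : ℕ → ℝ}
    (hf : HasGegenbauerExpansion n f a) (ha : ∀ k, 0 ≤ a k) (P : Finset (UnitSphere n)) :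
    HasSum (fun k => a k * moment k P) (∑ x ∈ P, ∑ y ∈ P, f (dot x y)) := by
  -- Nonnegative terms let convergence of the partial sums, pointwise in t, suffice for `HasSum`.
  rw [hasSum_iff_tendsto_nat_of_nonneg fun k => mul_nonneg (ha k) (moment_nonneg hn k P)]
  refine (tendsto_finsetSum P fun x _ => tendsto_finsetSum P fun y _ =>
    hf.tendsto_at (dot_mem_Icc x y)).congr fun N => ?_
  simp only [moment, Finset.mul_sum]
  rw [Finset.sum_comm (s := Finset.range N)]
  exact Finset.sum_congr rfl fun x _ => Finset.sum_comm

end Sphere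

end FDesign

theorem mainTheorem5 (n : ℕ) (hn : 2 ≤ n) (f : ℝ → ℝ) (a : ℕ → ℝ)
    (hf : FDesign.HasGegenbauerExpansion n f a) (ha : ∀ k : ℕ, 0 ≤ a k)
    (m : ℕ) (P : Finset (FDesign.UnitSphere n)) (hP : P.Nonempty) (hm : P.card = m)
    (hD : FDesign.innerProducts P ⊆ FDesign.zeroSet f) :
    FDesign.IsFDesign f a P ↔ f 1 = (m : ℝ) * a 0 := by
  subst hm
  have hm : (0 : ℝ) < P.card := by exact_mod_cast hP.card_pos
  have hs := hf.hasSum_moment hn ha P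
  rw [FDesign.sum_sum_dot hD] at hs
  constructor
  · intro h
    have h0 := hasSum_single (f := fun k => a k * FDesign.moment k P) 0 fun k hk => by
      by_cases hak : a k = 0
      · simp [hak]
      · simp [h.moment_eq_zero k (Nat.pos_of_ne_zero hk) hak]
    have e := hs.unique h0
    rw [FDesign.moment_zero] at e
    exact mul_left_cancel₀ hm.ne' (by linear_combination e)
  · refine fun h => ⟨fun k hk hak => ?_, hD⟩
    -- The terms 0 and k alone give m² a_0 + a_k M_k ≤ m f(1) = m² a_0.
    have hle := sum_le_hasSum {0, k}
      (fun j _ => mul_nonneg (ha j) (FDesign.moment_nonneg hn j P)) hs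
    rw [Finset.sum_pair hk.ne, FDesign.moment_zero, h] at hle
    have h1 : a k * FDesign.moment k P = 0 :=
      le_antisymm (by linarith) (mul_nonneg (ha k) (FDesign.moment_nonneg hn k P))
    exact (mul_eq_zero.mp h1).resolve_left hak
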